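/- Let $\lambda$ be an infinite cardinal and let $\kappa=(2^\lambda)^+$. Let $T(\kappa)$ be the graph whose vertices are all finite strictly increasing sequences of ordinals less than $\kappa$ (including the empty sequence), two vertices $s,t$ being joined by an edge if and only if one of them is a proper initial segment of the other. Then there is a graph $G_\kappa$ with exactly $\kappa$ vertices such that $G_\kappa\to(T(\kappa))^2_\lambda$; that is, for every colouring $c:E(G_\kappa)\to\lambda$ of the edges of $G_\kappa$ with $\lambda$ colours, there is an induced subgraph of $G_\kappa$ that is isomorphic to $T(\kappa)$ and all of whose edges have the same colour. -/

import Mathlib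

open Cardinal

universe u v w

/-- The vertex set of the `κ`-trees of height `ω`: the finite (strictly) increasing sequences of
ordinals in `κ`. -/
def IncSeq (κ : Cardinal.{u}) : Type (u + 1) :=
  {s : List Ordinal.{u} // s.Pairwise (· < ·) ∧ ∀ a ∈ s, a < κ.ord}

/-- `s ⊲ t`: the sequence `s` is a proper initial segment of `t`. -/
def IncSeq.ProperInitSeg {κ : Cardinal.{u}} (s t : IncSeq κ) : Prop :=
  s.1 <+: t.1 ∧ s.1.length < t.1.length

/-- The transitive `κ`-tree of height `ω`, `T(κ)`: two increasing sequences are joined by an edge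
when one of them is a proper initial segment of the other. -/
def transitiveTree (κ : Cardinal.{u}) : SimpleGraph (IncSeq κ) where
  Adj s t := s.ProperInitSeg t ∨ t.ProperInitSeg s
  symm := ⟨fun _ _ h => h.symm⟩
  loopless := ⟨fun _ h => h.elim (fun h => lt_irrefl _ h.2) (fun h => lt_irrefl _ h.2)⟩

/-- The partition relation `G → (H)²_μ`: for every colouring of the edges of `G` with `μ` colours
(the ordinals below the initial ordinal of `μ`) there is an induced copy of `H` in `G`, that is, an
embedding preserving both adjacency and non-adjacency, all of whose edges have the same colour. -/
def EdgeArrow {V : Type v} {W : Type w} (G : SimpleGraph V) (H : SimpleGraph W)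
    (μ : Cardinal.{u}) : Prop :=
  ∀ c : G.edgeSet → Set.Iio μ.ord,
    ∃ f : H ↪g G, ∀ e e' : H.edgeSet, c (f.mapEdgeSet e) = c (f.mapEdgeSet e')

/-!
The graph lives on `κ` many ordinals `δ < κ`, each in `μ · 2` copies `(δ, i, b)`. Such a vertex is
joined down to (all copies of) the ordinals below `δ` outside a sequence of `μ⁺` gaps. The gaps come
from a ladder of length `μ⁺` cofinal in `δ`: gap `α` starts at the least strict upper bound of the
ladder points before `α` and ends at the last point of a fixed club that is at most ladder point
`α`. The index `i < μ` names a bipartition of `μ⁺`, and only gaps in half `b` are left out. Two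
features matter: by a weak club guessing principle valid in ZFC (`exists_club_guess`), every club
contains the right ends of unboundedly many gaps for some `δ`, and the part of a neighbourhood
before a gap is one of only `2 ^ μ` many sets (`mk_gapTraces_le`).

Fix a colouring. For each colour consider the game in which a monochromatic chain is lengthened,
a challenge `ε` has to be answered by a vertex above `ε`, and a bounded trace of the neighbourhood
of the next vertex is prescribed (`Extends`). If some position with empty chain is winning, the
answers can be taken along an enumeration of the tree in type `κ`, always above everything built
earlier; the prescribed traces keep incomparable vertices non-adjacent (`exists_tree_of_extends`).

Otherwise all these positions are lost, and each carries a challenge that forces the rank down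
(`exists_winning_or_rank`). Take a club closed under the challenges and a `δ` whose gaps end in it
unboundedly often in both halves of bipartition `i` (`exists_unbounded_halves`). For `b` in `Bool`
and every colour `k` choose a position of minimal rank whose chain is joined to `(δ, i, b)` in colour
`k`. These `μ` many finite chains are bounded in `δ`, because `δ` has cofinality `μ⁺`, so the same
situation occurs at some `w < δ`. The gaps of the two halves are disjoint, so `(w, i, b)` is joined to
`(δ, i, b)` for some `b`; in the colour of this edge the minimal chain can be lengthened by
`(w, i, b)`, with smaller rank. This is the proof of `exists_winning_colour`.
-/

universe z

/-! ### Bounded families and closure points -/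

theorem Cardinal.IsRegular.exists_strict_bound {c : Cardinal.{u}} (hc : c.IsRegular) {ι : Type w}
    (f : ι → Ordinal.{u}) (hι : Cardinal.lift.{u} #ι < Cardinal.lift.{w} c)
    (hf : ∀ i, f i < c.ord) : ∃ b < c.ord, ∀ i, f i < b := by
  obtain ⟨a, ha, hac⟩ := Cardinal.lt_lift_iff.1 hι
  induction a using Cardinal.inductionOn with
  | _ α =>
  obtain ⟨g⟩ := Cardinal.lift_mk_eq'.1 hac
  refine ⟨⨆ i, f (g i) + 1, ?_, fun i => ?_⟩
  · exact Ordinal.iSup_add_one_lt_of_lt_cof (by rwa [hc.cof_ord]) fun i => hf _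
  · simpa using Ordinal.lt_iSup_add_one (fun i => f (g i)) (g.symm i)

theorem Cardinal.lift_mk_Iio_lt {c : Cardinal.{u}} {o : Ordinal.{u}} (ho : o < c.ord) :
    Cardinal.lift.{u} #(Set.Iio o) < Cardinal.lift.{u + 1} c := by
  rw [Cardinal.lift_id'.{u, u + 1}, Cardinal.mk_Iio_ordinal, Cardinal.lift_lt]
  exact Cardinal.lt_ord.1 ho

theorem Cardinal.IsRegular.exists_strict_bound_lt {c : Cardinal.{u}} (hc : c.IsRegular)
    {o : Ordinal.{u}} (ho : o < c.ord) {f : Ordinal.{u} → Ordinal.{u}}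
    (hf : ∀ a < o, f a < c.ord) : ∃ b < c.ord, ∀ a < o, f a < b := by
  obtain ⟨b, hb, h⟩ := hc.exists_strict_bound (fun a : Set.Iio o => f a)
    (Cardinal.lift_mk_Iio_lt ho) fun a => hf a a.2
  exact ⟨b, hb, fun a ha => h ⟨a, ha⟩⟩

/-- The ordinals closed under `Φ`. For `Φ` mapping a regular uncountable cardinal to itself they
form a club of that cardinal; conversely every club contains such a set apart from `0`, so these sets
stand for clubs throughout. -/
def closurePts (Φ : Ordinal.{u} → Ordinal.{u}) : Set Ordinal.{u} :=
  {δ | ∀ ζ < δ, Φ ζ < δ}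

/-- The largest closure point of `Ψ` that is at most `ξ`; the supremum is attained, and `0` is always
a closure point. -/
noncomputable def lastPt (Ψ : Ordinal.{u} → Ordinal.{u}) (ξ : Ordinal.{u}) : Ordinal.{u} :=
  sSup (closurePts Ψ ∩ Set.Iic ξ)

theorem zero_mem_closurePts (Φ : Ordinal.{u} → Ordinal.{u}) : 0 ∈ closurePts Φ :=
  fun _ h => (not_lt_zero h).elim

theorem closurePts_anti {Φ Ψ : Ordinal.{u} → Ordinal.{u}} (h : ∀ ζ, Φ ζ ≤ Ψ ζ) :
    closurePts Ψ ⊆ closurePts Φ :=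
  fun _ hδ ζ hζ => (h ζ).trans_lt (hδ ζ hζ)

theorem lastPt_le (Ψ : Ordinal.{u} → Ordinal.{u}) (ξ : Ordinal.{u}) : lastPt Ψ ξ ≤ ξ :=
  csSup_le' fun _ h => h.2

theorem le_lastPt {Ψ : Ordinal.{u} → Ordinal.{u}} {ξ δ : Ordinal.{u}} (hδ : δ ∈ closurePts Ψ)
    (h : δ ≤ ξ) : δ ≤ lastPt Ψ ξ :=
  le_csSup ⟨ξ, fun _ h => h.2⟩ ⟨hδ, h⟩

theorem lastPt_mem (Ψ : Ordinal.{u} → Ordinal.{u}) (ξ : Ordinal.{u}) :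
    lastPt Ψ ξ ∈ closurePts Ψ := by
  intro ζ hζ
  obtain ⟨a, ha, h⟩ := exists_lt_of_lt_csSup
    (⟨0, zero_mem_closurePts Ψ, Set.mem_Iic.2 zero_le⟩ : (closurePts Ψ ∩ Set.Iic ξ).Nonempty) hζ
  exact (ha.1 ζ h).trans_le (le_lastPt ha.1 ha.2)

theorem lastPt_mono (Ψ : Ordinal.{u} → Ordinal.{u}) {ξ ξ' : Ordinal.{u}} (h : ξ ≤ ξ') :
    lastPt Ψ ξ ≤ lastPt Ψ ξ' :=
  le_lastPt (lastPt_mem Ψ ξ) ((lastPt_le Ψ ξ).trans h)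

theorem lastPt_anti {Φ Ψ : Ordinal.{u} → Ordinal.{u}} (h : ∀ ζ, Φ ζ ≤ Ψ ζ) (ξ : Ordinal.{u}) :
    lastPt Ψ ξ ≤ lastPt Φ ξ :=
  le_lastPt (closurePts_anti h (lastPt_mem Ψ ξ)) (lastPt_le Ψ ξ)

/-! ### Ladders -/

/-- `f` restricted to the ordinals below `o` is strictly increasing and cofinal in `δ`. -/
structure IsLadder (o δ : Ordinal.{u}) (f : Ordinal.{u} → Ordinal.{u}) : Prop where
  strictMono : ∀ ⦃α β⦄, α < β → β < o → f α < f β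
  lt : ∀ ⦃α⦄, α < o → f α < δ
  cofinal : ∀ ζ < δ, ∃ α < o, ζ < f α

/-- The least strict upper bound of the values of `f` below `α`. -/
noncomputable def ladderSup (f : Ordinal.{u} → Ordinal.{u}) (α : Ordinal.{u}) : Ordinal.{u} :=
  sInf {b | ∀ β < α, f β < b}

theorem lt_ladderSup (f : Ordinal.{u} → Ordinal.{u}) {α β : Ordinal.{u}} (h : β < α) :
    f β < ladderSup f α := by
  have hne : {b | ∀ β < α, f β < b}.Nonempty :=
    ⟨⨆ i : Set.Iio α, f i + 1, fun β hβ =>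
      Ordinal.lt_iSup_add_one (fun i : Set.Iio α => f i) ⟨β, hβ⟩⟩
  exact csInf_mem hne β h

theorem ladderSup_le {f : Ordinal.{u} → Ordinal.{u}} {α b : Ordinal.{u}}
    (h : ∀ β < α, f β < b) : ladderSup f α ≤ b :=
  csInf_le' h

theorem ladderSup_congr {f g : Ordinal.{u} → Ordinal.{u}} {α : Ordinal.{u}}
    (h : ∀ β < α, f β = g β) : ladderSup f α = ladderSup g α := by
  unfold ladderSup
  congr 1
  ext b
  exact forall₂_congr fun β hβ => by rw [h β hβ]

theorem ladderSup_mono (f : Ordinal.{u} → Ordinal.{u}) {α β : Ordinal.{u}} (h : α ≤ β) :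
    ladderSup f α ≤ ladderSup f β :=
  ladderSup_le fun _ hγ => lt_ladderSup f (hγ.trans_le h)

theorem IsLadder.ladderSup_le {o δ : Ordinal.{u}} {f : Ordinal.{u} → Ordinal.{u}}
    (hf : IsLadder o δ f) {α : Ordinal.{u}} (hα : α < o) : ladderSup f α ≤ f α :=
  _root_.ladderSup_le fun _ hβ => hf.strictMono hβ hα

theorem IsLadder.monotone {o δ : Ordinal.{u}} {f : Ordinal.{u} → Ordinal.{u}}
    (hf : IsLadder o δ f) {α β : Ordinal.{u}} (h : α ≤ β) (hβ : β < o) : f α ≤ f β := by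
  rcases h.eq_or_lt with rfl | h
  · exact le_rfl
  · exact (hf.strictMono h hβ).le

/-- If the ladder has regular length, a proper initial segment of it is not cofinal in any point
that itself carries a ladder of the same length. -/
theorem IsLadder.ladderSup_lt {c : Cardinal.{u}} (hc : c.IsRegular) {q : Ordinal.{u}}
    {g f : Ordinal.{u} → Ordinal.{u}} (hg : IsLadder c.ord q g) {α : Ordinal.{u}}
    (hα : α < c.ord) (h : ∀ β < α, f β < q) : ladderSup f α < q := by
  have h' : ∀ β, ∃ γ, β < α → γ < c.ord ∧ f β < g γ := fun β => by
    by_cases hβ : β < α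
    · obtain ⟨γ, h1, h2⟩ := hg.cofinal _ (h β hβ)
      exact ⟨γ, fun _ => ⟨h1, h2⟩⟩
    · exact ⟨0, fun h => (hβ h).elim⟩
  choose γ hγ using h'
  obtain ⟨b, hb, hb'⟩ := hc.exists_strict_bound_lt hα (fun β hβ => (hγ β hβ).1)
  refine (_root_.ladderSup_le fun β hβ => ?_).trans_lt (hg.lt hb)
  exact (hγ β hβ).2.trans (hg.strictMono (hb' β hβ) hb)

theorem exists_ladder_closurePts {κ c : Cardinal.{u}} (hκ : κ.IsRegular) (hc : c.IsRegular)
    (hcκ : c < κ) {Φ : Ordinal.{u} → Ordinal.{u}} (hΦ : ∀ ζ < κ.ord, Φ ζ < κ.ord)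
    {ζ : Ordinal.{u}} (hζ : ζ < κ.ord) :
    ∃ δ < κ.ord, ζ < δ ∧ δ ∈ closurePts Φ ∧ ∃ f, IsLadder c.ord δ f := by
  have hlim := Cardinal.isSuccLimit_ord hκ.aleph0_le
  have hlim' := Cardinal.isSuccLimit_ord hc.aleph0_le
  have hN : ∀ b, ∃ b', b < κ.ord → b' < κ.ord ∧ b < b' ∧ ∀ ξ ≤ b, Φ ξ < b' := by
    intro b
    by_cases hb : b < κ.ord
    · obtain ⟨b', h1, h2⟩ := hκ.exists_strict_bound_lt (hlim.succ_lt hb)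
        (fun a ha => hΦ a (ha.trans (hlim.succ_lt hb)))
      refine ⟨max b' (Order.succ b), fun _ => ⟨max_lt h1 (hlim.succ_lt hb),
        lt_max_of_lt_right (Order.lt_succ b), fun ξ hξ =>
        lt_max_of_lt_left (h2 ξ (Order.lt_succ_of_le hξ))⟩⟩
    · exact ⟨0, fun h => (hb h).elim⟩
  choose N hN using hN
  obtain ⟨s, hs⟩ : ∃ s : Ordinal.{u} → Ordinal.{u},
      ∀ α, s α = sInf {x | ζ < x ∧ ∀ β < α, N (s β) < x} :=
    ⟨WellFoundedLT.fix fun α ih => sInf {x | ζ < x ∧ ∀ β, ∀ h : β < α, N (ih β h) < x},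
      fun α => WellFoundedLT.fix_eq _ _⟩
  have key : ∀ α < κ.ord, s α < κ.ord ∧ ζ < s α ∧ ∀ β < α, N (s β) < s α := by
    intro α
    induction α using WellFoundedLT.induction with
    | _ α ih =>
    intro hα
    obtain ⟨b, hb, hb'⟩ := hκ.exists_strict_bound_lt hα (f := fun β => N (s β))
      (fun β hβ => (hN _ (ih β hβ (hβ.trans hα)).1).1)
    have hmem : max b (Order.succ ζ) ∈ {x | ζ < x ∧ ∀ β < α, N (s β) < x} :=
      ⟨lt_max_of_lt_right (Order.lt_succ ζ), fun β hβ => lt_max_of_lt_left (hb' β hβ)⟩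
    have h1 := csInf_mem (Set.nonempty_of_mem hmem)
    have h2 := csInf_le' hmem
    rw [← hs] at h1 h2
    exact ⟨h2.trans_lt (max_lt hb (hlim.succ_lt hζ)), h1.1, h1.2⟩
  have hcκ' : c.ord < κ.ord := Cardinal.ord_lt_ord.2 hcκ
  have hmono : ∀ ⦃α β⦄, α < β → β < c.ord → s α < s β := fun α β h hβ =>
    (hN _ (key α (h.trans (hβ.trans hcκ'))).1).2.1.trans ((key β (hβ.trans hcκ')).2.2 α h)
  have hlt : ladderSup s c.ord < κ.ord := by
    obtain ⟨b, hb, hb'⟩ := hκ.exists_strict_bound_lt hcκ'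
      (fun β hβ => (key β (hβ.trans hcκ')).1)
    exact (ladderSup_le hb').trans_lt hb
  have hcof : ∀ ξ < ladderSup s c.ord, ∃ α < c.ord, ξ < s α := by
    intro ξ hξ
    by_contra! hcon
    exact absurd (ladderSup_le (f := s) (b := ξ) fun β hβ =>
      (hmono (Order.lt_succ β) (hlim'.succ_lt hβ)).trans_le (hcon _ (hlim'.succ_lt hβ))) hξ.not_ge
  have h0 : (0 : Ordinal) < c.ord := hlim'.bot_lt
  refine ⟨_, hlt, (key 0 (h0.trans hcκ')).2.1.trans (lt_ladderSup s h0), fun ξ hξ => ?_, s,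
    hmono, fun α hα => lt_ladderSup s hα, hcof⟩
  obtain ⟨α, hα, h⟩ := hcof ξ hξ
  have hα' := hlim'.succ_lt hα
  exact ((hN _ (key α (hα.trans hcκ')).1).2.2 ξ h.le).trans
    (((key _ (hα'.trans hcκ')).2.2 α (Order.lt_succ α)).trans (lt_ladderSup s hα'))

/-! ### Guessing clubs by shifted ladders -/

theorem exists_unbounded_of_forall_exists {c : Cardinal.{u}} (hc : c.IsRegular) {ι : Type w}
    (hι : Cardinal.lift.{u} #ι < Cardinal.lift.{w} c) {P : ι → Ordinal.{u} → Prop}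
    (h : ∀ α₀ < c.ord, ∃ i, ∃ α < c.ord, α₀ ≤ α ∧ P i α) :
    ∃ i, ∀ α₀ < c.ord, ∃ α < c.ord, α₀ ≤ α ∧ P i α := by
  by_contra! hcon
  choose b hb hb' using hcon
  obtain ⟨a, ha, ha'⟩ := hc.exists_strict_bound b hι hb
  obtain ⟨i, α, hα, h1, h2⟩ := h a ha
  exact hb' i α hα ((ha' i).le.trans h1) h2

/-- A weak club guessing principle. Each ladder point `e δ α` is moved down to the last closure
point of one fixed `Ψ`; then for every club some `δ` in it has unboundedly many nonempty intervals
`[ladderSup (e δ) α, lastPt Ψ (e δ α))` whose right end lies in the club. If this failed for every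
`Ψ`, each `Ψₙ` would have a bad club, giving a larger `Ψₙ₊₁`. For a `δ` closed under all of these,
`lastPt Ψₙ (e δ α)` decreases with `n`, so it is eventually constant for each `α`; one `n` serves
unboundedly many `α`, whose points then lie in the bad club of `Ψₙ`. -/
theorem exists_club_guess {κ c : Cardinal.{u}} (hκ : κ.IsRegular) (hc : c.IsRegular)
    (hc₀ : ℵ₀ < c) (hcκ : c < κ) (e : Ordinal.{u} → Ordinal.{u} → Ordinal.{u})
    (he : ∀ δ, (∃ f, IsLadder c.ord δ f) → IsLadder c.ord δ (e δ)) :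
    ∃ Ψ : Ordinal.{u} → Ordinal.{u}, ∀ Φ : Ordinal.{u} → Ordinal.{u},
      (∀ ζ < κ.ord, Φ ζ < κ.ord) →
      ∃ δ < κ.ord, δ ∈ closurePts Φ ∧ IsLadder c.ord δ (e δ) ∧
        ∀ α₀ < c.ord, ∃ α < c.ord, α₀ ≤ α ∧ ladderSup (e δ) α < lastPt Ψ (e δ α) ∧
          lastPt Ψ (e δ α) ∈ closurePts Φ := by
  by_contra! hcon
  choose F hF hFbad using hcon
  -- the iteration, keeping each function above all earlier ones
  let S : ℕ → Ordinal.{u} → Ordinal.{u} := fun n =>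
    Nat.rec (fun _ => 0) (fun _ Ψ ζ => max (Ψ ζ) (F Ψ ζ)) n
  have hS1 : ∀ n ζ, S (n + 1) ζ = max (S n ζ) (F (S n) ζ) := fun _ _ => rfl
  have hSκ : ∀ n, ∀ ζ < κ.ord, S n ζ < κ.ord := by
    intro n
    induction n with
    | zero => exact fun ζ h => (zero_le).trans_lt h
    | succ n ih => exact fun ζ h => by rw [hS1]; exact max_lt (ih ζ h) (hF _ ζ h)
  have hω : ∀ ζ, ∃ b, ζ < κ.ord → b < κ.ord ∧ ∀ n, S n ζ < b := by
    intro ζ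
    by_cases h : ζ < κ.ord
    · obtain ⟨b, hb, hb'⟩ := hκ.exists_strict_bound (fun n : ℕ => S n ζ)
        (by simpa using hc₀.trans hcκ) fun n => hSκ n ζ h
      exact ⟨b, fun _ => ⟨hb, hb'⟩⟩
    · exact ⟨0, fun h' => (h h').elim⟩
  choose Sω hSω using hω
  have hq : ∀ ζ, ∃ q, ζ < κ.ord → q < κ.ord ∧ ζ < q ∧ q ∈ closurePts Sω ∧
      ∃ f, IsLadder c.ord q f := by
    intro ζ
    by_cases h : ζ < κ.ord
    · obtain ⟨q, hq⟩ := exists_ladder_closurePts hκ hc hcκ (fun ζ h => (hSω ζ h).1) h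
      exact ⟨q, fun _ => hq⟩
    · exact ⟨0, fun h' => (h h').elim⟩
  choose q hq using hq
  have hmem : ∀ δ < κ.ord, δ ∈ closurePts Sω → ∀ n, δ ∈ closurePts (S n) := fun δ hδ h n ζ hζ =>
    ((hSω ζ (hζ.trans hδ)).2 n).trans (h ζ hζ)
  obtain ⟨δ, hδ, -, hδcl, hlad⟩ := exists_ladder_closurePts hκ hc hcκ
    (Φ := fun ζ => max (Sω ζ) (q ζ)) (fun ζ h => max_lt (hSω ζ h).1 (hq ζ h).1)
    (Cardinal.isSuccLimit_ord hκ.aleph0_le).bot_lt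
  have hδω : δ ∈ closurePts Sω := closurePts_anti (fun ζ => le_max_left _ _) hδcl
  have hδq : δ ∈ closurePts q := closurePts_anti (fun ζ => le_max_right _ _) hδcl
  have hl := he δ hlad
  obtain ⟨n, hn⟩ := exists_unbounded_of_forall_exists hc (ι := ℕ)
    (P := fun n α => ladderSup (e δ) α < lastPt (S n) (e δ α) ∧
      lastPt (S n) (e δ α) ∈ closurePts (F (S n))) (by simpa using hc₀) (by
    intro α₀ hα₀
    have hζ := hl.lt hα₀
    obtain ⟨hqκ, hqlt, hqcl, g, hg⟩ := hq _ (hζ.trans hδ)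
    have hqδ := hδq _ hζ
    -- the first ladder point at or above a closure point `q` of cofinality `c`
    let α := sInf {α | α < c.ord ∧ q (e δ α₀) ≤ e δ α}
    have hne : {α | α < c.ord ∧ q (e δ α₀) ≤ e δ α}.Nonempty := by
      obtain ⟨α, h1, h2⟩ := hl.cofinal _ hqδ
      exact ⟨α, h1, h2.le⟩
    have hα : α < c.ord ∧ q (e δ α₀) ≤ e δ α := csInf_mem hne
    have hsmall : ∀ β < α, e δ β < q (e δ α₀) := fun β hβ => by
      by_contra! h
      exact (csInf_le' (show β ∈ {α | α < c.ord ∧ q (e δ α₀) ≤ e δ α} from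
        ⟨hβ.trans hα.1, h⟩)).not_gt hβ
    have hsup := hg.ladderSup_lt hc hα.1 hsmall
    have hge : ∀ n, q (e δ α₀) ≤ lastPt (S n) (e δ α) := fun n =>
      le_lastPt (hmem _ hqκ hqcl n) hα.2
    have hα₀α : α₀ ≤ α := by
      by_contra! h
      exact (hqlt.trans_le (hα.2.trans (hl.monotone h.le hα₀))).false
    have hstab : ∃ n, lastPt (S n) (e δ α) = lastPt (S (n + 1)) (e δ α) := by
      by_contra! h
      have hd : StrictAnti fun n => lastPt (S n) (e δ α) := strictAnti_nat_of_succ_lt fun n =>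
        lt_of_le_of_ne (lastPt_anti (fun ζ => le_max_left _ _) _) (h n).symm
      exact not_strictAnti_of_wellFoundedLT _ hd
    obtain ⟨n, hn⟩ := hstab
    refine ⟨n, α, hα.1, hα₀α, hsup.trans_le (hge n), ?_⟩
    rw [hn]
    exact closurePts_anti (fun ζ => le_max_right _ _) (lastPt_mem (S (n + 1)) _))
  obtain ⟨α₀, h1, h2⟩ := hFbad (S n) δ hδ
    (closurePts_anti (fun ζ => le_max_right _ _) (hmem δ hδ hδω (n + 1))) hl
  obtain ⟨α, h3, h4, h5, h6⟩ := hn α₀ h1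
  exact h2 α h3 h4 h5 h6

/-- An unbounded subset of a regular cardinal is split into two unbounded pieces by one of any fewer
bipartitions that separate points. -/
theorem exists_unbounded_halves {c : Cardinal.{u}} (hc : c.IsRegular) {K : Type w}
    (hK : Cardinal.lift.{u} #K < Cardinal.lift.{w} c) {r : Ordinal.{u} → K → Bool}
    (hr : Set.InjOn r (Set.Iio c.ord)) {P : Ordinal.{u} → Prop}
    (hP : ∀ α₀ < c.ord, ∃ α < c.ord, α₀ ≤ α ∧ P α) :
    ∃ i, ∀ b, ∀ α₀ < c.ord, ∃ α < c.ord, α₀ ≤ α ∧ P α ∧ r α i = b := by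
  by_contra! hcon
  choose b a ha h using hcon
  obtain ⟨a', ha', hlt⟩ := hc.exists_strict_bound a hK ha
  have hconst : ∀ α < c.ord, a' ≤ α → P α → r α = fun i => !(b i) := fun α h1 h2 h3 => by
    funext i
    have := h i α h1 ((hlt i).le.trans h2) h3
    revert this
    cases r α i <;> cases b i <;> simp
  obtain ⟨α, h1, h2, h3⟩ := hP a' ha'
  obtain ⟨β, h4, h5, h6⟩ :=
    hP (Order.succ α) ((Cardinal.isSuccLimit_ord hc.aleph0_le).succ_lt h1)
  have hαβ : α < β := Order.succ_le_iff.1 h5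
  exact hαβ.ne (hr h1 h4 ((hconst α h1 h2 h3).trans (hconst β h4 (h2.trans hαβ.le) h6).symm))

/-! ### Ranks for a two-player game -/

/-- Position `s` is lost with rank `α` for the player who, given a challenge `ε`, has to move from
`s` to some `s'` with `R ε s s'`: some challenge admits only replies of smaller rank. -/
inductive LostAt {E σ : Type v} (R : E → σ → σ → Prop) : Ordinal.{v} → σ → Prop
  | mk (α : Ordinal.{v}) (s : σ) (ε : E) (f : σ → Ordinal.{v}) (hf : ∀ s', R ε s s' → f s' < α)
      (h : ∀ s', R ε s s' → LostAt R (f s') s') : LostAt R α s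

/-- The positions split into a set `G` on which every challenge can be answered inside `G`, and
the others, where the fixed challenge `g s` forces a descent in rank. -/
theorem exists_winning_or_rank {E σ : Type v} [Nonempty E] (R : E → σ → σ → Prop) :
    ∃ (G : Set σ) (g : σ → E) (rk : σ → Ordinal.{v}),
      (∀ s ∈ G, ∀ ε, ∃ s' ∈ G, R ε s s') ∧
      ∀ s ∉ G, ∀ s', R (g s) s s' → s' ∉ G ∧ rk s' < rk s := by
  have hg : ∀ s, ∃ ε, (∃ α, LostAt R α s) → ∀ s', R ε s s' →
      ∃ β < sInf {α | LostAt R α s}, LostAt R β s' := by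
    intro s
    by_cases h : ∃ α, LostAt R α s
    · obtain ⟨_, _, ε, f, hf, hl⟩ := csInf_mem (s := {α | LostAt R α s}) h
      exact ⟨ε, fun _ s' hs' => ⟨f s', hf s' hs', hl s' hs'⟩⟩
    · exact ⟨Classical.arbitrary E, fun h' => (h h').elim⟩
  choose g hg using hg
  refine ⟨{s | ¬∃ α, LostAt R α s}, g, fun s => sInf {α | LostAt R α s}, ?_, ?_⟩
  · intro s hs ε
    by_contra! hcon
    have hα : ∀ s', ∃ α, R ε s s' → LostAt R α s' := fun s' => by
      by_cases h : R ε s s'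
      · by_cases h' : ∃ α, LostAt R α s'
        · exact h'.imp fun α h _ => h
        · exact (hcon s' (fun α hα => h' ⟨α, hα⟩) h).elim
      · exact ⟨0, fun h' => (h h').elim⟩
    choose f hf using hα
    exact hs ⟨_, LostAt.mk (⨆ s', f s' + 1) s ε f (fun s' _ => Ordinal.lt_iSup_add_one f s') hf⟩
  · intro s hs s' h
    obtain ⟨β, h1, h2⟩ := hg s (not_not.1 hs) s' h
    exact ⟨not_not.2 ⟨β, h2⟩, (csInf_le' (s := {α | LostAt R α s'}) h2).trans_lt h1⟩

/-! ### Enumerating the tree -/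

namespace IncSeq

variable {κ : Cardinal.{u}}

/-- The least ordinal above all entries. -/
noncomputable def top (t : IncSeq κ) : Ordinal.{u} := sInf {b | ∀ a ∈ t.1, a < b}

theorem lt_top (t : IncSeq κ) {a : Ordinal.{u}} (h : a ∈ t.1) : a < t.top :=
  csInf_mem (s := {b | ∀ a ∈ t.1, a < b}) ⟨κ.ord, t.2.2⟩ a h

theorem top_le (t : IncSeq κ) {b : Ordinal.{u}} (h : ∀ a ∈ t.1, a < b) : t.top ≤ b :=
  csInf_le' h

theorem ProperInitSeg.top_lt {s t : IncSeq κ} (h : s.ProperInitSeg t) : s.top < t.top := by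
  obtain ⟨⟨q, hq⟩, hlen⟩ := h
  cases q with
  | nil => simp [← hq] at hlen
  | cons x q =>
    have hp := t.2.1
    rw [← hq, List.pairwise_append] at hp
    exact (s.top_le fun a ha => hp.2.2 a ha x (by simp)).trans_lt (t.lt_top (by simp [← hq]))

theorem top_lt_ord (hκ : κ.IsRegular) (t : IncSeq κ) : t.top < κ.ord := by
  obtain ⟨b, hb, h⟩ := hκ.exists_strict_bound (fun a : {a // a ∈ t.1} => a.1)
    ((Cardinal.lift_lt_aleph0.2 (Cardinal.lt_aleph0_of_finite _)).trans_le
      (by simpa using hκ.aleph0_le)) fun a => t.2.2 a a.2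
  exact (t.top_le fun a ha => h ⟨a, ha⟩).trans_lt hb

/-- Injective code for `t`, by the largest entry first. Proper initial segments get smaller codes,
and fewer than `κ` sequences have a code below a given one. -/
noncomputable def code (t : IncSeq κ) : Ordinal.{u} ×ₗ Ordinal.{u + 1} :=
  toLex (t.top, Ordinal.typein WellOrderingRel t)

theorem code_injective : Function.Injective (code (κ := κ)) := fun s t h => by
  have := congrArg (fun p => (ofLex p).2) h
  exact Ordinal.typein_injective _ this

theorem ProperInitSeg.code_lt {s t : IncSeq κ} (h : s.ProperInitSeg t) : s.code < t.code :=
  Prod.Lex.toLex_lt_toLex.2 (Or.inl h.top_lt)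

theorem exists_bound_code_lt (hκ : κ.IsRegular) (hκ₀ : ℵ₀ < κ) (t : IncSeq κ)
    (f : IncSeq κ → Ordinal.{u}) (hf : ∀ s, s.code < t.code → f s < κ.ord) :
    ∃ b < κ.ord, ∀ s, s.code < t.code → f s < b := by
  have hmem : ∀ s : IncSeq κ, s.code < t.code → ∀ a ∈ s.1, a < t.top := fun s hs a ha =>
    (s.lt_top ha).trans_le (by
      rcases Prod.Lex.toLex_lt_toLex.1 hs with h | h
      exacts [h.le, h.1.le])
  have hcard : #{s : IncSeq κ // s.code < t.code} ≤ #(List (Set.Iio t.top)) := by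
    refine Cardinal.mk_le_of_injective
      (f := fun s => s.1.1.attach.map fun a => ⟨a.1, hmem s.1 s.2 a.1 a.2⟩) fun s s' h => ?_
    have := congrArg (List.map Subtype.val) h
    simp only [List.map_map, Function.comp_def] at this
    exact Subtype.ext (Subtype.ext (by simpa using this))
  obtain ⟨b, hb, h⟩ := hκ.exists_strict_bound
    (fun s : {s : IncSeq κ // s.code < t.code} => f s.1) (by
      refine (Cardinal.lift_le.2 (hcard.trans (Cardinal.mk_list_le_max _))).trans_lt ?_
      rw [Cardinal.lift_max]
      refine max_lt (by simpa using hκ₀) (Cardinal.lift_mk_Iio_lt (t.top_lt_ord hκ)))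
    fun s => hf s.1 s.2
  exact ⟨b, hb, fun s hs => h ⟨s, hs⟩⟩

/-- The sequence without its last entry. -/
def parent (t : IncSeq κ) : IncSeq κ :=
  ⟨t.1.dropLast, t.2.1.sublist (List.dropLast_sublist _),
    fun a ha => t.2.2 a (List.dropLast_subset _ ha)⟩

theorem properInitSeg_iff {s t : IncSeq κ} :
    s.ProperInitSeg t ↔ t.1 ≠ [] ∧ s.1 <+: t.parent.1 := by
  rcases List.eq_nil_or_concat t.1 with h | ⟨l, a, h⟩
  · simp [ProperInitSeg, h]
  · rw [List.concat_eq_append] at h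
    have : t.parent.1 = l := by simp [parent, h]
    rw [this, ProperInitSeg, h]
    constructor
    · rintro ⟨h1, h2⟩
      refine ⟨by simp, ?_⟩
      rw [List.prefix_concat_iff] at h1
      rcases h1 with h1 | h1
      · simp [h1] at h2
      · exact h1
    · rintro ⟨-, h1⟩
      exact ⟨h1.trans (List.prefix_append _ _), by simpa using Nat.lt_succ_of_le h1.length_le⟩

theorem parent_properInitSeg {t : IncSeq κ} (h : t.1 ≠ []) : t.parent.ProperInitSeg t :=
  properInitSeg_iff.2 ⟨h, List.prefix_refl _⟩

theorem prefix_iff {s t : IncSeq κ} : s.1 <+: t.1 ↔ s = t ∨ s.ProperInitSeg t := by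
  constructor
  · intro h
    rcases h.length_le.eq_or_lt with h' | h'
    · exact Or.inl (Subtype.ext (h.eq_of_length h'))
    · exact Or.inr ⟨h, h'⟩
  · rintro (rfl | h)
    exacts [List.prefix_refl _, h.1]

end IncSeq

/-! ### Building a monochromatic copy of the tree -/

/-- One move of the game for colour `k` on a graph whose vertices `y` have a height and are joined
down exactly to the vertices with height in `Dn y`. A position `(X, D)` consists of the chain `X`
built so far and the set `D` of heights that the neighbourhood of the next vertex must cut out of a
bounded part of the ordinals. Given the challenge `ε`, the reply is a vertex `y` whose neighbourhood
below some `ε' ≥ ε` is `D`, joined to `X` in colour `k`, and a new set `D'` that contains the height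
of `y` and agrees with `D` below `ε'`. -/
def Extends {V : Type v} {K : Type w} [DecidableEq V] (ht : V → Ordinal.{u})
    (Dn : V → Set Ordinal.{u}) (c : V → V → K) (k : K) (ε : Ordinal.{u})
    (s s' : Finset V × Set Ordinal.{u}) : Prop :=
  ∃ (ε' : Ordinal.{u}) (y : V), ε ≤ ε' ∧ ε' ≤ ht y ∧ Dn y ∩ Set.Iio ε' = s.2 ∧
    (∀ x ∈ s.1, c x y = k) ∧ s'.1 = insert y s.1 ∧ s'.2 ∩ Set.Iio ε' = s.2 ∧ ht y ∈ s'.2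

theorem exists_tree_of_extends {κ : Cardinal.{u}} (hκ : κ.IsRegular) (hκ₀ : ℵ₀ < κ)
    {V : Type v} {K : Type w} [DecidableEq V] {ht : V → Ordinal.{u}} {Dn : V → Set Ordinal.{u}}
    {c : V → V → K} {k : K} (hht : ∀ y, ht y < κ.ord) (hDn : ∀ y, Dn y ⊆ Set.Iio (ht y))
    {G : Set (Finset V × Set Ordinal.{u})}
    (hG : ∀ s ∈ G, ∀ ε < κ.ord, ∃ s' ∈ G, Extends ht Dn c k ε s s') {D₀ : Set Ordinal.{u}}
    (h₀ : (∅, D₀) ∈ G) :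
    ∃ F : IncSeq κ → V, Function.Injective F ∧
      (∀ s t, ht (F s) ∈ Dn (F t) ↔ s.ProperInitSeg t) ∧
      ∀ s t, s.ProperInitSeg t → c (F s) (F t) = k := by
  have hlim := Cardinal.isSuccLimit_ord hκ.aleph0_le
  have hκpos : (0 : Ordinal) < κ.ord := hlim.bot_lt
  have hne : Nonempty V := by
    obtain ⟨_, _, _, y, _⟩ := hG _ h₀ 0 hκpos
    exact ⟨y⟩
  -- sets occurring in winning positions are bounded
  have hbd : ∀ s : Finset V × Set Ordinal.{u}, ∃ b, s ∈ G → b < κ.ord ∧ s.2 ⊆ Set.Iio b := by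
    intro s
    by_cases hs : s ∈ G
    · obtain ⟨s', _, ε', y, _, h1, h2, _⟩ := hG s hs 0 hκpos
      exact ⟨ε', fun _ => ⟨h1.trans_lt (hht y), by rw [← h2]; exact Set.inter_subset_right⟩⟩
    · exact ⟨0, fun h => (hs h).elim⟩
  choose bd hbd using hbd
  -- a move from `s` against the challenge `ε`: the bound, the vertex, the new position
  have hnext : ∀ (s : Finset V × Set Ordinal.{u}) (ε : Ordinal.{u}),
      ∃ p : Ordinal.{u} × V × (Finset V × Set Ordinal.{u}), s ∈ G → ε < κ.ord →
        p.2.2 ∈ G ∧ ε ≤ p.1 ∧ p.1 ≤ ht p.2.1 ∧ Dn p.2.1 ∩ Set.Iio p.1 = s.2 ∧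
        (∀ x ∈ s.1, c x p.2.1 = k) ∧ p.2.2.1 = insert p.2.1 s.1 ∧
        p.2.2.2 ∩ Set.Iio p.1 = s.2 ∧ ht p.2.1 ∈ p.2.2.2 := by
    intro s ε
    by_cases hs : s ∈ G ∧ ε < κ.ord
    · obtain ⟨s', hs', ε', y, h⟩ := hG s hs.1 ε hs.2
      exact ⟨(ε', y, s'), fun _ _ => ⟨hs', h⟩⟩
    · exact ⟨(0, Classical.arbitrary V, s), fun h1 h2 => (hs ⟨h1, h2⟩).elim⟩
  choose next hnext using hnext
  let A := Ordinal.{u} × V × (Finset V × Set Ordinal.{u})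
  have hwf : WellFounded fun s t : IncSeq κ => s.code < t.code :=
    InvImage.wf IncSeq.code wellFounded_lt
  classical
  obtain ⟨W, hW⟩ : ∃ W : IncSeq κ → A, ∀ t, W t =
      next (if t.1 = [] then (∅, D₀) else (W t.parent).2.2)
        (sInf {b | ∀ s, s.code < t.code → max (bd (W s).2.2) (ht (W s).2.1) < b}) := by
    refine ⟨hwf.fix fun t ih => next
      (if h : t.1 = [] then (∅, D₀)
        else (ih t.parent (IncSeq.parent_properInitSeg h).code_lt).2.2)
      (sInf {b | ∀ s, ∀ h : s.code < t.code, max (bd (ih s h).2.2) (ht (ih s h).2.1) < b}), ?_⟩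
    intro t
    rw [hwf.fix_eq]
    by_cases h : t.1 = [] <;> simp [h]
  let prev : IncSeq κ → Finset V × Set Ordinal.{u} := fun t =>
    if t.1 = [] then (∅, D₀) else (W t.parent).2.2
  have key : ∀ t, (∀ s, s.code < t.code →
      (W s).2.2.2 ⊆ Set.Iio (W t).1 ∧ ht (W s).2.1 < (W t).1) ∧
      (W t).2.2 ∈ G ∧ (W t).1 ≤ ht (W t).2.1 ∧
      Dn (W t).2.1 ∩ Set.Iio (W t).1 = (prev t).2 ∧ (∀ x ∈ (prev t).1, c x (W t).2.1 = k) ∧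
      (W t).2.2.1 = insert (W t).2.1 (prev t).1 ∧
      (W t).2.2.2 ∩ Set.Iio (W t).1 = (prev t).2 ∧ ht (W t).2.1 ∈ (W t).2.2.2 := by
    intro t
    induction t using hwf.induction with
    | _ t ih =>
    have hprev : prev t ∈ G := by
      by_cases h : t.1 = []
      · simpa [prev, h] using h₀
      · simpa [prev, h] using (ih _ (IncSeq.parent_properInitSeg h).code_lt).2.1
    obtain ⟨b, hb, hlt⟩ := t.exists_bound_code_lt hκ hκ₀
      (fun s => max (bd (W s).2.2) (ht (W s).2.1)) fun s hs =>
        max_lt (hbd _ (ih s hs).2.1).1 (hht _)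
    have hmem := csInf_mem
      (s := {b | ∀ s : IncSeq κ, s.code < t.code → max (bd (W s).2.2) (ht (W s).2.1) < b}) ⟨b, hlt⟩
    have hle := csInf_le' (s := {b | ∀ s : IncSeq κ, s.code < t.code →
      max (bd (W s).2.2) (ht (W s).2.1) < b}) hlt
    obtain ⟨h1, h2, h3⟩ := hnext (prev t) _ hprev (hle.trans_lt hb)
    rw [← hW t] at h1 h2 h3
    refine ⟨fun s hs => ?_, h1, h3⟩
    have hs' := (hmem s hs).trans_le h2
    exact ⟨(hbd _ (ih s hs).2.1).2.trans (Set.Iio_subset_Iio ((le_max_left _ _).trans hs'.le)),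
      (le_max_right _ _).trans_lt hs'⟩
  have hstrict : ∀ s t : IncSeq κ, s.code < t.code → ht (W s).2.1 < ht (W t).2.1 :=
    fun s t h => ((key t).1 s h).2.trans_le (key t).2.2.1
  have hD : ∀ t s : IncSeq κ, ht (W s).2.1 ∈ (W t).2.2.2 ↔ s.1 <+: t.1 := by
    intro t
    induction t using hwf.induction with
    | _ t ih =>
    intro s
    rcases lt_trichotomy s.code t.code with h | h | h
    · have hst : s ≠ t := fun h' => h.ne (congrArg _ h')
      have ht0 : t.1 ≠ [] := fun h0 => by
        have hs0 : s.1 ≠ [] := fun hs0 => hst (Subtype.ext (hs0.trans h0.symm))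
        have : t.ProperInitSeg s := by
          rw [IncSeq.ProperInitSeg, h0]
          exact ⟨List.nil_prefix, List.length_pos_iff.2 hs0⟩
        exact (this.code_lt.trans h).false
      have hiff : ht (W s).2.1 ∈ (W t).2.2.2 ↔ ht (W s).2.1 ∈ (prev t).2 := by
        rw [← (key t).2.2.2.2.2.2.1]
        exact ⟨fun hm => ⟨hm, ((key t).1 s h).2⟩, fun hm => hm.1⟩
      rw [hiff, IncSeq.prefix_iff, or_iff_right hst, IncSeq.properInitSeg_iff,
        ← ih _ (IncSeq.parent_properInitSeg ht0).code_lt]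
      simp [prev, ht0]
    · obtain rfl := IncSeq.code_injective h
      simpa using (key s).2.2.2.2.2.2.2
    · refine iff_of_false (fun hm => ?_) fun hp => ?_
      · exact (((key s).1 t h).1 hm).not_ge (key s).2.2.1
      · rcases IncSeq.prefix_iff.1 hp with rfl | hp
        · exact h.false
        · exact (hp.code_lt.trans h).false
  have hX : ∀ t s : IncSeq κ, s.1 <+: t.1 → (W s).2.1 ∈ (W t).2.2.1 := by
    intro t
    induction t using hwf.induction with
    | _ t ih =>
    intro s hs
    rw [(key t).2.2.2.2.2.1]
    rcases IncSeq.prefix_iff.1 hs with rfl | hs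
    · exact Finset.mem_insert_self _ _
    · obtain ⟨h0, hs⟩ := IncSeq.properInitSeg_iff.1 hs
      refine Finset.mem_insert_of_mem ?_
      simpa [prev, h0] using ih _ (IncSeq.parent_properInitSeg h0).code_lt s hs
  refine ⟨fun t => (W t).2.1, fun s t h => ?_, fun s t => ?_, fun s t h => ?_⟩
  · rcases lt_trichotomy s.code t.code with h' | h' | h'
    · exact ((hstrict s t h').ne (congrArg ht h)).elim
    · exact IncSeq.code_injective h'
    · exact ((hstrict t s h').ne (congrArg ht h).symm).elim
  · constructor
    · intro hm
      have hcode : s.code < t.code := by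
        by_contra! h
        rcases h.eq_or_lt with h | h
        · rw [IncSeq.code_injective h] at hm
          exact (Set.mem_Iio.1 (hDn _ hm)).false.elim
        · exact (hDn _ hm).not_gt (hstrict t s h)
      have hm' : ht (W s).2.1 ∈ (prev t).2 := by
        rw [← (key t).2.2.2.1]
        exact ⟨hm, ((key t).1 s hcode).2⟩
      rw [← (key t).2.2.2.2.2.2.1] at hm'
      exact (IncSeq.prefix_iff.1 ((hD t s).1 hm'.1)).resolve_left fun h =>
        hcode.ne (congrArg _ h)
    · intro h
      have hm : ht (W s).2.1 ∈ (prev t).2 := by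
        rw [← (key t).2.2.2.2.2.2.1]
        exact ⟨(hD t s).2 h.1, ((key t).1 s h.code_lt).2⟩
      rw [← (key t).2.2.2.1] at hm
      exact hm.1
  · obtain ⟨h0, hp⟩ := IncSeq.properInitSeg_iff.1 h
    refine (key t).2.2.2.2.1 _ ?_
    simpa [prev, h0] using hX _ s hp

/-! ### Neighbourhoods with gaps -/

/-- The ordinals below `δ` outside the gaps `[ladderSup f α, lastPt Ψ (f α))`, for those `α < o` that
lie in half `b` of the bipartition with index `i`. -/
def gapNbhd {K : Type w} (o : Ordinal.{u}) (Ψ : Ordinal.{u} → Ordinal.{u})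
    (r : Ordinal.{u} → K → Bool) (f : Ordinal.{u} → Ordinal.{u}) (δ : Ordinal.{u}) (i : K)
    (b : Bool) : Set Ordinal.{u} :=
  {ξ | ξ < δ ∧ ∀ α < o, r α i = b → ξ < ladderSup f α ∨ lastPt Ψ (f α) ≤ ξ}

/-- The part of `gapNbhd` before the gap with index `α`; only the values of `f` below `α` matter. -/
def gapTrace {K : Type w} (Ψ : Ordinal.{u} → Ordinal.{u}) (r : Ordinal.{u} → K → Bool)
    (f : Ordinal.{u} → Ordinal.{u}) (α : Ordinal.{u}) (i : K) (b : Bool) : Set Ordinal.{u} :=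
  {ξ | ξ < ladderSup f α ∧ ∀ β < α, r β i = b → ξ < ladderSup f β ∨ lastPt Ψ (f β) ≤ ξ}

theorem gapTrace_congr {K : Type w} (Ψ : Ordinal.{u} → Ordinal.{u}) (r : Ordinal.{u} → K → Bool)
    {f g : Ordinal.{u} → Ordinal.{u}} {α : Ordinal.{u}} (h : ∀ β < α, f β = g β) (i : K)
    (b : Bool) : gapTrace Ψ r f α i b = gapTrace Ψ r g α i b := by
  ext ξ
  refine and_congr (by rw [ladderSup_congr h]) (forall₂_congr fun β hβ => ?_)
  rw [ladderSup_congr fun γ hγ => h γ (hγ.trans hβ), h β hβ]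

section gapNbhd

variable {K : Type w} {o δ : Ordinal.{u}} {Ψ : Ordinal.{u} → Ordinal.{u}}
  {r : Ordinal.{u} → K → Bool} {f : Ordinal.{u} → Ordinal.{u}}

theorem gapNbhd_inter_ladderSup (hf : IsLadder o δ f) {α : Ordinal.{u}} (hα : α < o) (i : K)
    (b : Bool) : gapNbhd o Ψ r f δ i b ∩ Set.Iio (ladderSup f α) = gapTrace Ψ r f α i b := by
  ext ξ
  constructor
  · rintro ⟨⟨-, h⟩, h'⟩
    exact ⟨h', fun β hβ => h β (hβ.trans hα)⟩
  · rintro ⟨h', h⟩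
    refine ⟨⟨h'.trans ((hf.ladderSup_le hα).trans_lt (hf.lt hα)), fun β _ hb => ?_⟩, h'⟩
    rcases lt_or_ge β α with hβ | hβ
    · exact h β hβ hb
    · exact Or.inl (h'.trans_le (ladderSup_mono f hβ))

theorem gapNbhd_inter_lastPt (hf : IsLadder o δ f) {α : Ordinal.{u}} (hα : α < o) {i : K}
    {b : Bool} (hr : r α i = b) (hlt : ladderSup f α < lastPt Ψ (f α)) :
    gapNbhd o Ψ r f δ i b ∩ Set.Iio (lastPt Ψ (f α)) = gapTrace Ψ r f α i b := by
  rw [← gapNbhd_inter_ladderSup hf hα]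
  ext ξ
  refine and_congr_right fun h => ⟨fun h' => ?_, fun h' => lt_trans h' hlt⟩
  exact (h.2 α hα hr).resolve_right (not_le.2 h')

/-- The gaps for different `α` are disjoint, so the two halves leave out disjoint sets. -/
theorem exists_mem_gapNbhd {ξ : Ordinal.{u}} (hξ : ξ < δ) (i : K) :
    ∃ b, ξ ∈ gapNbhd o Ψ r f δ i b := by
  by_contra! hcon
  have h : ∀ b, ∃ α < o, r α i = b ∧ ladderSup f α ≤ ξ ∧ ξ < lastPt Ψ (f α) := by
    intro b
    by_contra! hb
    exact hcon b ⟨hξ, fun α hα hr => (lt_or_ge ξ (ladderSup f α)).imp id (hb α hα hr)⟩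
  obtain ⟨α, hα, hrα, h1, h2⟩ := h true
  obtain ⟨β, hβ, hrβ, h3, h4⟩ := h false
  rcases lt_trichotomy α β with hαβ | rfl | hαβ
  · exact (h3.trans_lt (h2.trans_le (lastPt_le Ψ _))).not_gt (lt_ladderSup f hαβ)
  · exact Bool.noConfusion (hrα.symm.trans hrβ)
  · exact (h1.trans_lt (h4.trans_le (lastPt_le Ψ _))).not_gt (lt_ladderSup f hαβ)

end gapNbhd

/-! ### Counting bounded data -/

/-- The traces that come from ladder segments of length below `o` with values below `ζ`. -/
def gapTraces {K : Type w} (o : Ordinal.{u}) (Ψ : Ordinal.{u} → Ordinal.{u})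
    (r : Ordinal.{u} → K → Bool) (ζ : Ordinal.{u}) : Set (Set Ordinal.{u}) :=
  {D | ∃ (f : Ordinal.{u} → Ordinal.{u}) (α : Ordinal.{u}) (i : K) (b : Bool),
    α < o ∧ (∀ β < α, f β < ζ) ∧ gapTrace Ψ r f α i b = D}

theorem mk_Iio_le_lift {a : Cardinal.{u}} {ζ : Ordinal.{u}} (h : ζ < (Order.succ a).ord) :
    #(Set.Iio ζ) ≤ lift.{u + 1} a := by
  rw [Cardinal.mk_Iio_ordinal, Cardinal.lift_le]
  exact Order.lt_succ_iff.1 (Cardinal.lt_ord.1 h)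

theorem mk_prod_le_of_le {θ : Cardinal.{w}} (hθ : ℵ₀ ≤ θ) {A B : Type w} (hA : #A ≤ θ)
    (hB : #B ≤ θ) : #(A × B) ≤ θ := by
  rw [Cardinal.mk_prod, Cardinal.lift_id, Cardinal.lift_id]
  exact Cardinal.mul_le_of_le hθ hA hB

theorem mk_prod_bool_le_of_le {θ : Cardinal.{w}} (hθ : ℵ₀ ≤ θ) {A : Type w} (hA : #A ≤ θ) :
    #(A × Bool) ≤ θ := by
  rw [Cardinal.mk_prod, Cardinal.lift_uzero]
  exact Cardinal.mul_le_of_le hθ hA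
    ((Cardinal.lift_le_aleph0.2 Cardinal.mk_le_aleph0).trans hθ)

theorem mk_bool_pi_le_of_le {θ : Cardinal.{w}} (hθ : ℵ₀ ≤ θ) {A : Type w} (hA : #A ≤ θ) :
    #(Bool → A) ≤ θ := by
  rw [(Equiv.boolArrowEquivProd A).cardinal_eq]
  exact mk_prod_le_of_le hθ hA hA

theorem mk_finset_le_of_le {θ : Cardinal.{w}} (hθ : ℵ₀ ≤ θ) {A : Type w} (hA : #A ≤ θ) :
    #(Finset A) ≤ θ := by
  classical
  exact (Cardinal.mk_le_of_surjective List.toFinset_surjective).trans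
    ((Cardinal.mk_list_le_max A).trans (max_le hθ hA))

theorem mk_gapTraces_le {μ : Cardinal.{u}} (hμ : ℵ₀ ≤ μ) {K : Type (u + 1)}
    (hK : #K = lift.{u + 1} μ) (Ψ : Ordinal.{u} → Ordinal.{u}) (r : Ordinal.{u} → K → Bool)
    {ζ : Ordinal.{u}} (hζ : ζ < (Order.succ ((2 : Cardinal.{u}) ^ μ)).ord) :
    #(gapTraces (Order.succ μ).ord Ψ r ζ) ≤ lift.{u + 1} (2 ^ μ) := by
  have hθ : ℵ₀ ≤ lift.{u + 1} (2 ^ μ) := by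
    exact Cardinal.aleph0_le_lift.2 (hμ.trans (Cardinal.cantor μ).le)
  let C := Σ α : Set.Iio (Order.succ μ).ord, (Set.Iio α.1 → Set.Iio ζ) × K × Bool
  let F : C → Set Ordinal.{u} := fun x => gapTrace Ψ r
    (fun β => if h : β < x.1.1 then (x.2.1 ⟨β, h⟩).1 else 0) x.1.1 x.2.2.1 x.2.2.2
  have hsub : gapTraces (Order.succ μ).ord Ψ r ζ ⊆ Set.range F := by
    rintro _ ⟨f, α, i, b, hα, hf, rfl⟩
    refine ⟨⟨⟨α, hα⟩, fun β => ⟨f β.1, hf β.1 β.2⟩, i, b⟩, gapTrace_congr Ψ r (fun β hβ => ?_) i b⟩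
    simp [hβ]
  refine (Cardinal.mk_le_mk_of_subset hsub).trans (Cardinal.mk_range_le.trans ?_)
  have hone : ∀ α : Set.Iio (Order.succ μ).ord,
      #((Set.Iio α.1 → Set.Iio ζ) × K × Bool) ≤ lift.{u + 1} (2 ^ μ) := by
    intro α
    have h1 : #(Set.Iio α.1 → Set.Iio ζ) ≤ lift.{u + 1} (2 ^ μ) := by
      rw [← Cardinal.power_def]
      calc #(Set.Iio ζ) ^ #(Set.Iio α.1) ≤ lift.{u + 1} (2 ^ μ) ^ #(Set.Iio α.1) :=
            Cardinal.power_le_power_right (mk_Iio_le_lift hζ)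
        _ ≤ lift.{u + 1} (2 ^ μ) ^ lift.{u + 1} μ :=
            Cardinal.power_le_power_left (Cardinal.aleph0_pos.trans_le hθ).ne'
              (mk_Iio_le_lift α.2)
        _ = lift.{u + 1} (2 ^ μ) := by
            rw [← Cardinal.lift_power, ← Cardinal.power_mul, Cardinal.mul_eq_self hμ]
    have h2 : #K ≤ lift.{u + 1} (2 ^ μ) := by
      rw [hK, Cardinal.lift_le]; exact (Cardinal.cantor μ).le
    exact mk_prod_le_of_le hθ h1 (mk_prod_bool_le_of_le hθ h2)
  rw [Cardinal.mk_sigma]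
  refine (Cardinal.sum_le_sum _ (fun _ => lift.{u + 1} (2 ^ μ)) hone).trans ?_
  rw [Cardinal.sum_const, Cardinal.lift_id, Cardinal.lift_id]
  refine Cardinal.mul_le_of_le hθ ((mk_Iio_le_lift (a := 2 ^ μ) ?_)) le_rfl
  exact Cardinal.ord_lt_ord.2 (Order.succ_lt_succ (Cardinal.cantor μ))

/-! ### Vertices and winning positions -/

/-- Vertices of the graph: an ordinal below `κ` together with a half of a bipartition. -/
abbrev GapVertex (κ : Cardinal.{u}) (K : Type w) : Type (max w (u + 1)) :=
  Set.Iio κ.ord × K × Bool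

theorem mk_heightBounded_finset_le {κ : Cardinal.{u}} {K : Type (u + 1)} {θ : Cardinal.{u + 1}}
    (hθ : ℵ₀ ≤ θ) (hK : #K ≤ θ) {ζ : Ordinal.{u}} (hζ : #(Set.Iio ζ) ≤ θ) :
    #{X : Finset (GapVertex κ K) // ∀ x ∈ X, x.1.1 < ζ} ≤ θ := by
  classical
  have h1 : #{x : GapVertex κ K // x.1.1 < ζ} ≤ θ := by
    refine (Cardinal.mk_le_of_injective
      (f := fun x => ((⟨x.1.1.1, x.2⟩, x.1.2) : Set.Iio ζ × K × Bool)) fun x y h => ?_).trans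
      (mk_prod_le_of_le hθ hζ (mk_prod_bool_le_of_le hθ hK))
    have h1 : x.1.1.1 = y.1.1.1 :=
      congrArg (fun p : Set.Iio ζ × K × Bool => p.1.1) h
    have h2 : x.1.2 = y.1.2 :=
      congrArg (fun p : Set.Iio ζ × K × Bool => p.2) h
    exact Subtype.ext (Prod.ext (Subtype.ext h1) h2)
  refine (Cardinal.mk_le_of_injective
    (f := fun X : {X : Finset (GapVertex κ K) // ∀ x ∈ X, x.1.1 < ζ} =>
      X.1.subtype fun x => x.1.1 < ζ) fun X Y h => ?_).trans (mk_finset_le_of_le hθ h1)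
  have := congrArg (Finset.map (Function.Embedding.subtype _)) h
  simp only [Finset.subtype_map] at this
  rw [Finset.filter_true_of_mem X.2, Finset.filter_true_of_mem Y.2] at this
  exact Subtype.ext this

section Winning

variable {μ : Cardinal.{u}} {K : Type (u + 1)}

/-- In some colour a position with empty chain is winning. Otherwise every position met below is
lost, with a fixed challenge and a rank. Guess a ladder on a club closed under these challenges and
under the least point where given bounded data reappear, and for the vertices `y b` at its top choose
in every colour `k` a valid position of minimal rank. All these positions together are bounded data,
so they fit some earlier vertex `x` too, which is joined to one `y b` since the gaps of the two
halves are disjoint. In the colour of that edge, appending `x` lowers the rank. -/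
theorem exists_winning_colour (hμ : ℵ₀ ≤ μ) (hK : #K = lift.{u + 1} μ) [DecidableEq K]
    {κ : Cardinal.{u}} (hκ : κ = Order.succ (2 ^ μ))
    {Ψ : Ordinal.{u} → Ordinal.{u}} {r : Ordinal.{u} → K → Bool}
    (hr : Set.InjOn r (Set.Iio (Order.succ μ).ord)) {e : Ordinal.{u} → Ordinal.{u} → Ordinal.{u}}
    (hguess : ∀ Φ : Ordinal.{u} → Ordinal.{u}, (∀ ζ < κ.ord, Φ ζ < κ.ord) →
      ∃ δ < κ.ord, δ ∈ closurePts Φ ∧ IsLadder (Order.succ μ).ord δ (e δ) ∧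
        ∀ α₀ < (Order.succ μ).ord, ∃ α < (Order.succ μ).ord, α₀ ≤ α ∧
          ladderSup (e δ) α < lastPt Ψ (e δ α) ∧ lastPt Ψ (e δ α) ∈ closurePts Φ)
    (c : GapVertex κ K → GapVertex κ K → K) :
    ∃ (k : K) (G : Set (Finset (GapVertex κ K) × Set Ordinal.{u})) (D₀ : Set Ordinal.{u}),
      (∅, D₀) ∈ G ∧ ∀ s ∈ G, ∀ ε < κ.ord, ∃ s' ∈ G, Extends (fun y => y.1.1)
        (fun y => gapNbhd (Order.succ μ).ord Ψ r (e y.1.1) y.1.1 y.2.1 y.2.2) c k ε s s' := by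
  set o := (Order.succ μ).ord with ho
  set ht : GapVertex κ K → Ordinal.{u} := fun y => y.1.1 with hht
  set Dn : GapVertex κ K → Set Ordinal.{u} :=
    fun y => gapNbhd o Ψ r (e y.1.1) y.1.1 y.2.1 y.2.2 with hDn
  have hreg : (Order.succ μ).IsRegular := Cardinal.isRegular_succ hμ
  have hθ' : ℵ₀ ≤ (2 : Cardinal.{u}) ^ μ := hμ.trans (Cardinal.cantor μ).le
  have hκreg : κ.IsRegular := hκ ▸ Cardinal.isRegular_succ hθ'
  have hκlim := Cardinal.isSuccLimit_ord hκreg.aleph0_le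
  have holim := Cardinal.isSuccLimit_ord hreg.aleph0_le
  have hθ : ℵ₀ ≤ lift.{u + 1} ((2 : Cardinal.{u}) ^ μ) := Cardinal.aleph0_le_lift.2 hθ'
  have hKθ : #K ≤ lift.{u + 1} ((2 : Cardinal.{u}) ^ μ) := by
    rw [hK, Cardinal.lift_le]; exact (Cardinal.cantor μ).le
  have hKpow : ∀ {A : Type (u + 1)}, #A ≤ lift.{u + 1} ((2 : Cardinal.{u}) ^ μ) →
      #(K → A) ≤ lift.{u + 1} ((2 : Cardinal.{u}) ^ μ) := fun {A} hA => by
    rw [← Cardinal.power_def, hK]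
    refine (Cardinal.power_le_power_right hA).trans ?_
    rw [← Cardinal.lift_power, ← Cardinal.power_mul, Cardinal.mul_eq_self hμ]
  have hbound : ∀ {ι : Type (u + 1)} (F : ι → Ordinal.{u}),
      #ι ≤ lift.{u + 1} ((2 : Cardinal.{u}) ^ μ) → (∀ i, F i < κ.ord) →
      ∃ b < κ.ord, ∀ i, F i < b := fun {ι} F hι hF => by
    refine hκreg.exists_strict_bound F ?_ hF
    rw [Cardinal.lift_id'.{u, u + 1}]
    refine hι.trans_lt ?_
    rw [hκ, Cardinal.lift_lt]
    exact Order.lt_succ _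
  have hsmall : ∀ ζ < κ.ord, #(Set.Iio ζ) ≤ lift.{u + 1} ((2 : Cardinal.{u}) ^ μ) := fun ζ h =>
    mk_Iio_le_lift (by rwa [hκ] at h)
  have hoK : Cardinal.lift.{u} #K < Cardinal.lift.{u + 1} (Order.succ μ) := by
    rw [Cardinal.lift_id'.{u, u + 1}, hK, Cardinal.lift_lt]
    exact Order.lt_succ μ
  have : Nonempty (Set.Iio κ.ord) := ⟨⟨0, hκlim.bot_lt⟩⟩
  -- winning positions, challenges and ranks for every colour
  choose G g rk hG hdesc using fun k : K => exists_winning_or_rank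
    (E := Set.Iio κ.ord) (fun ε => Extends ht Dn c k ε.1)
  by_contra! hcon
  have hlost : ∀ k D, (∅, D) ∉ G k := fun k D hD => by
    obtain ⟨s, hs, ε, hε, h⟩ := hcon k (G k) D hD
    obtain ⟨s', hs', h'⟩ := hG k s hs ⟨ε, hε⟩
    exact h s' hs' h'
  -- the least place where the data `(i, γ, D, X)` reappear
  let Chains : Ordinal.{u} → Type (u + 1) := fun ζ =>
    {X : Finset (GapVertex κ K) // ∀ x ∈ X, ht x < ζ}
  let Match : K → (Bool → Ordinal.{u}) → (Bool → Set Ordinal.{u}) →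
      (Bool → K → Finset (GapVertex κ K)) → Set Ordinal.{u} := fun i γ D X =>
    {ξ | ∃ h : ξ < κ.ord, ∀ b, γ b ≤ ξ ∧ Dn (⟨ξ, h⟩, i, b) ∩ Set.Iio (γ b) = D b ∧
      ∀ k, ∀ x ∈ X b k, c x (⟨ξ, h⟩, i, b) = k}
  have hMatch : ∀ i γ D X, sInf (Match i γ D X) < κ.ord := by
    intro i γ D X
    rcases (Match i γ D X).eq_empty_or_nonempty with h | h
    · rw [h, Ordinal.sInf_empty]; exact hκlim.bot_lt
    · exact (csInf_mem h).1
  have hΦ : ∀ ζ, ∃ b, ζ < κ.ord → b < κ.ord ∧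
      (∀ k X D, (∀ x ∈ X, ht x < ζ) → D ∈ gapTraces o Ψ r ζ → (g k (X, D)).1 < b) ∧
      ∀ i γ D X, (∀ b, γ b < ζ) → (∀ b, D b ∈ gapTraces o Ψ r ζ) →
        (∀ b k, ∀ x ∈ X b k, ht x < ζ) → sInf (Match i γ D X) < b := by
    intro ζ
    by_cases hζ : ζ < κ.ord
    · have hT : #(gapTraces o Ψ r ζ) ≤ lift.{u + 1} ((2 : Cardinal.{u}) ^ μ) :=
        mk_gapTraces_le hμ hK Ψ r (by rwa [hκ] at hζ)
      have hF : #(Chains ζ) ≤ lift.{u + 1} ((2 : Cardinal.{u}) ^ μ) :=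
        mk_heightBounded_finset_le hθ hKθ (hsmall ζ hζ)
      obtain ⟨b₁, hb₁, h₁⟩ := hbound
        (fun p : K × Chains ζ × gapTraces o Ψ r ζ => (g p.1 (p.2.1.1, p.2.2.1)).1)
        (mk_prod_le_of_le hθ hKθ (mk_prod_le_of_le hθ hF hT)) fun p => (g _ _).2
      obtain ⟨b₂, hb₂, h₂⟩ := hbound
        (fun p : K × (Bool → Set.Iio ζ) × (Bool → gapTraces o Ψ r ζ) × (Bool → K → Chains ζ) =>
          sInf (Match p.1 (fun b => (p.2.1 b).1) (fun b => (p.2.2.1 b).1)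
            fun b k => (p.2.2.2 b k).1))
        (mk_prod_le_of_le hθ hKθ (mk_prod_le_of_le hθ (mk_bool_pi_le_of_le hθ (hsmall ζ hζ))
          (mk_prod_le_of_le hθ (mk_bool_pi_le_of_le hθ hT)
            (mk_bool_pi_le_of_le hθ (hKpow hF))))) fun p => hMatch _ _ _ _
      exact ⟨max b₁ b₂, fun _ => ⟨max_lt hb₁ hb₂,
        fun k X D hX hD => lt_max_of_lt_left (h₁ (k, ⟨X, hX⟩, ⟨D, hD⟩)),
        fun i γ D X hγ hD hX => lt_max_of_lt_right (h₂ (i, fun b => ⟨γ b, hγ b⟩,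
          fun b => ⟨D b, hD b⟩, fun b k => ⟨X b k, hX b k⟩))⟩⟩
    · exact ⟨0, fun h => (hζ h).elim⟩
  choose Φ hΦ using hΦ
  obtain ⟨δ, hδκ, hδΦ, hl, hu⟩ := hguess Φ fun ζ h => (hΦ ζ h).1
  obtain ⟨i, hi⟩ := exists_unbounded_halves hreg hoK hr hu
  let y : Bool → GapVertex κ K := fun b => (⟨δ, hδκ⟩, i, b)
  let η : Ordinal.{u} → Ordinal.{u} := ladderSup (e δ)
  let γ : Ordinal.{u} → Ordinal.{u} := fun α => lastPt Ψ (e δ α)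
  let T : Bool → Ordinal.{u} → Set Ordinal.{u} := fun b α => gapTrace Ψ r (e δ) α i b
  let Spot : Bool → Ordinal.{u} → Prop := fun b α =>
    α < o ∧ η α < γ α ∧ γ α ∈ closurePts Φ ∧ r α i = b
  have hspot : ∀ b, ∀ α₀ < o, ∃ α, α₀ ≤ α ∧ Spot b α := fun b α₀ h => by
    obtain ⟨α, h1, h2, ⟨h3, h4⟩, h5⟩ := hi b α₀ h
    exact ⟨α, h2, h1, h3, h4, h5⟩
  have hγδ : ∀ α < o, γ α < δ := fun α h => (lastPt_le Ψ _).trans_lt (hl.lt h)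
  have hγmono : ∀ {α β}, α ≤ β → β < o → γ α ≤ γ β := fun h hβ =>
    lastPt_mono Ψ (hl.monotone h hβ)
  have hTη : ∀ b α, α < o → Dn (y b) ∩ Set.Iio (η α) = T b α := fun b α h =>
    gapNbhd_inter_ladderSup hl h i b
  have hcut : ∀ {b α}, Spot b α → Dn (y b) ∩ Set.Iio (γ α) = T b α := fun h =>
    gapNbhd_inter_lastPt hl h.1 h.2.2.2 h.2.1
  have hTmem : ∀ b α ζ, α < o → η α ≤ ζ → T b α ∈ gapTraces o Ψ r ζ := fun b α ζ h h' =>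
    ⟨e δ, α, i, b, h, fun β hβ => (lt_ladderSup (e δ) hβ).trans_le h', rfl⟩
  have hshrink : ∀ {P Q : Set Ordinal.{u}} {a a'}, P ∩ Set.Iio a = Q ∩ Set.Iio a → a' ≤ a →
      P ∩ Set.Iio a' = Q ∩ Set.Iio a' := fun {P Q a a'} h h' => by
    rw [← Set.inter_eq_right.2 (Set.Iio_subset_Iio h'), ← Set.inter_assoc, h, Set.inter_assoc]
  -- lost positions whose chain is joined to `y b` in colour `k`, with the challenge met at `α`
  let Valid : Bool → K → Finset (GapVertex κ K) × Set Ordinal.{u} → Ordinal.{u} → Prop :=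
    fun b k s α => s ∉ G k ∧ Spot b α ∧ s.2 = T b α ∧ (g k s).1 < γ α ∧
      (∀ x ∈ s.1, ht x ∈ s.2) ∧ ∀ x ∈ s.1, c x (y b) = k
  have hchallenge : ∀ b k X α, Spot b α → (∀ x ∈ X, ht x < η α) →
      (g k (X, T b α)).1 < γ α := fun b k X α h hX => by
    have hη : η α < κ.ord := h.2.1.trans ((hγδ α h.1).trans hδκ)
    exact ((hΦ _ hη).2.1 k X _ hX (hTmem b α _ h.1 le_rfl)).trans (h.2.2.1 _ h.2.1)
  have hmin : ∀ b k, ∃ s α, Valid b k s α ∧ ∀ s' α', Valid b k s' α' → ¬rk k s' < rk k s := by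
    intro b k
    obtain ⟨α, -, hα⟩ := hspot b 0 holim.bot_lt
    obtain ⟨s, ⟨α', hs⟩, hs'⟩ := (InvImage.wf (rk k) wellFounded_lt).has_min
      {s | ∃ α, Valid b k s α} ⟨(∅, T b α), α, hlost k _, hα, rfl,
        hchallenge b k ∅ α hα (by simp), by simp, by simp⟩
    exact ⟨s, α', hs, fun s' α' h => hs' s' ⟨α', h⟩⟩
  choose S A hV hmin using hmin
  -- a gap beyond all those used by the minimal positions
  have hlast : ∀ b, ∃ α, Spot b α ∧ ∀ k, A b k ≤ α := fun b => by
    obtain ⟨a, ha, h⟩ := hreg.exists_strict_bound (A b) hoK fun k => (hV b k).2.1.1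
    obtain ⟨α, h1, h2⟩ := hspot b a ha
    exact ⟨α, h2, fun k => (h k).le.trans h1⟩
  choose α hα hAα using hlast
  have hγA : ∀ b k, γ (A b k) ≤ γ (α b) := fun b k => hγmono (hAα b k) (hα b).1
  obtain ⟨ζ, hζδ, hζ⟩ : ∃ ζ < δ, ∀ b, γ (α b) < ζ := by
    obtain ⟨β, hβ, h⟩ := hl.cofinal (max (γ (α true)) (γ (α false)))
      (max_lt (hγδ _ (hα true).1) (hγδ _ (hα false).1))
    refine ⟨e δ β, hl.lt hβ, fun b => ?_⟩
    cases b
    exacts [(le_max_right _ _).trans_lt h, (le_max_left _ _).trans_lt h]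
  have hδmem : δ ∈ Match i (fun b => γ (α b)) (fun b => T b (α b)) fun b k => (S b k).1 :=
    ⟨hδκ, fun b => ⟨(hγδ _ (hα b).1).le, hcut (hα b), fun k => (hV b k).2.2.2.2.2⟩⟩
  have hw := csInf_mem ⟨δ, hδmem⟩
  have hwδ : sInf (Match i (fun b => γ (α b)) (fun b => T b (α b)) fun b k => (S b k).1) < δ := by
    refine ((hΦ ζ (hζδ.trans hδκ)).2.2 _ _ _ _ hζ
      (fun b => hTmem b _ _ (hα b).1 ((hα b).2.1.trans (hζ b)).le) fun b k x hx => ?_).trans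
      (hδΦ ζ hζδ)
    have h := (hV b k).2.2.2.2.1 x hx
    rw [(hV b k).2.2.1, ← hcut (hV b k).2.1] at h
    exact (lt_of_lt_of_le h.2 (hγA b k)).trans (hζ b)
  generalize sInf (Match i (fun b => γ (α b)) (fun b => T b (α b)) fun b k => (S b k).1) = w
    at hw hwδ
  obtain ⟨hwκ, hw⟩ := hw
  obtain ⟨b, hb⟩ : ∃ b, w ∈ Dn (y b) :=
    exists_mem_gapNbhd (o := o) (Ψ := Ψ) (r := r) (f := e δ) hwδ i
  obtain ⟨h1, h2, h3⟩ := hw b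
  -- appending the earlier match to the minimal position of its colour contradicts minimality
  set x : GapVertex κ K := (⟨w, hwκ⟩, i, b) with hx
  obtain ⟨k, hk⟩ : ∃ k, c x (y b) = k := ⟨_, rfl⟩
  obtain ⟨β, hβ, hwβ⟩ := hl.cofinal w hwδ
  obtain ⟨α', hα'le, hα'⟩ := hspot b (max (Order.succ β) (α b))
    (max_lt (holim.succ_lt hβ) (hα b).1)
  have hwη : w < η α' := hwβ.trans
    (lt_ladderSup (e δ) (Order.succ_le_iff.1 ((le_max_left _ _).trans hα'le)))
  obtain ⟨hs1, hs2, hs3, hs4, hs5, hs6⟩ := hV b k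
  have hγα' : γ (A b k) ≤ γ α' := (hγA b k).trans (hγmono ((le_max_right _ _).trans hα'le) hα'.1)
  have hTα' : T b α' ∩ Set.Iio (γ (A b k)) = (S b k).2 := by
    rw [← hcut hα', Set.inter_assoc, Set.inter_eq_right.2 (Set.Iio_subset_Iio hγα'), hcut hs2, hs3]
  have hwT : w ∈ T b α' := by
    rw [← hTη b α' hα'.1]
    exact ⟨hb, hwη⟩
  have hext : Extends ht Dn c k (g k (S b k)).1 (S b k) (insert x (S b k).1, T b α') := by
    refine ⟨γ (A b k), x, hs4.le, (hγA b k).trans h1, ?_, h3 k, rfl, hTα', hwT⟩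
    rw [hshrink (h2.trans (hcut (hα b)).symm) (hγA b k), hcut hs2, hs3]
  obtain ⟨hnot, hlt⟩ := hdesc k _ hs1 _ hext
  have hhts : ∀ z ∈ insert x (S b k).1, ht z ∈ T b α' := by
    intro z hz
    rcases Finset.mem_insert.1 hz with rfl | hz
    · exact hwT
    · exact (hTα'.symm ▸ hs5 z hz : ht z ∈ T b α' ∩ Set.Iio (γ (A b k))).1
  refine hmin b k (insert x (S b k).1, T b α') α' ⟨hnot, hα', rfl,
    hchallenge b k _ α' hα' fun z hz => (hhts z hz).1, hhts, fun z hz => ?_⟩ hlt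
  rcases Finset.mem_insert.1 hz with rfl | hz
  · exact hk
  · exact hs6 z hz

end Winning

/-! ### The graph and its arrow -/

/-- Two vertices are joined when the height of one belongs to the gapped neighbourhood of the
other. -/
def gapGraph {κ : Cardinal.{u}} {K : Type w} (o : Ordinal.{u}) (Ψ : Ordinal.{u} → Ordinal.{u})
    (r : Ordinal.{u} → K → Bool) (e : Ordinal.{u} → Ordinal.{u} → Ordinal.{u}) :
    SimpleGraph (GapVertex κ K) where
  Adj x y := x.1.1 ∈ gapNbhd o Ψ r (e y.1.1) y.1.1 y.2.1 y.2.2 ∨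
    y.1.1 ∈ gapNbhd o Ψ r (e x.1.1) x.1.1 x.2.1 x.2.2
  symm := ⟨fun _ _ h => h.symm⟩
  loopless := ⟨fun _ h => h.elim (fun h => lt_irrefl _ h.1) fun h => lt_irrefl _ h.1⟩

theorem mk_gapVertex {μ κ : Cardinal.{u}} (hμ : ℵ₀ ≤ μ) (hκ : ℵ₀ ≤ κ) (hμκ : μ ≤ κ)
    {K : Type (u + 1)} (hK : #K = lift.{u + 1} μ) : #(GapVertex κ K) = lift.{u + 1} κ := by
  have hK0 : #(K × Bool) ≠ 0 := by
    have : Nonempty K := Cardinal.mk_ne_zero_iff.1 (by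
      rw [hK]; exact (Cardinal.aleph0_pos.trans_le (Cardinal.aleph0_le_lift.2 hμ)).ne')
    exact Cardinal.mk_ne_zero _
  rw [GapVertex, Cardinal.mk_prod, Cardinal.lift_id, Cardinal.lift_id, Cardinal.mk_Iio_ordinal,
    Cardinal.card_ord]
  exact Cardinal.mul_eq_left (Cardinal.aleph0_le_lift.2 hκ)
    (mk_prod_bool_le_of_le (Cardinal.aleph0_le_lift.2 hκ) (by rwa [hK, Cardinal.lift_le])) hK0

/-- Arrows are inherited by isomorphic copies in other universes. -/
theorem EdgeArrow.comap_equiv {V : Type v} {V' : Type w} {W : Type z} {G : SimpleGraph V}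
    {H : SimpleGraph W} {μ : Cardinal.{u}} (φ : V' ≃ V) (h : EdgeArrow G H μ) :
    EdgeArrow (G.comap φ) H μ := by
  intro c
  let ψ : G ≃g G.comap φ := (SimpleGraph.Iso.comap φ G).symm
  obtain ⟨f, hf⟩ := h fun x => c (ψ.mapEdgeSet x)
  refine ⟨ψ.toEmbedding.comp f, fun a b => ?_⟩
  have h1 : ∀ a, (SimpleGraph.Embedding.comp ψ.toEmbedding f).mapEdgeSet a =
      ψ.mapEdgeSet (f.mapEdgeSet a) := by
    rintro ⟨a, ha⟩
    induction a using Sym2.inductionOn with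
    | _ x y => rfl
  rw [h1, h1]
  exact hf a b

theorem theorem1 (μ κ : Cardinal.{u}) (hμ : ℵ₀ ≤ μ) (hκ : κ = Order.succ (2 ^ μ)) :
    ∃ (V : Type u) (G : SimpleGraph V), #V = κ ∧ EdgeArrow G (transitiveTree κ) μ := by
  classical
  have hμθ := Cardinal.cantor μ
  have hμκ : μ < κ := hκ ▸ hμθ.trans (Order.lt_succ _)
  have hκreg : κ.IsRegular := hκ ▸ Cardinal.isRegular_succ (hμ.trans hμθ.le)
  have hreg := Cardinal.isRegular_succ hμ
  have hK : #(Set.Iio μ.ord) = lift.{u + 1} μ := by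
    rw [Cardinal.mk_Iio_ordinal, Cardinal.card_ord]
  have hne : Nonempty (Set.Iio μ.ord) := ⟨⟨0, (Cardinal.isSuccLimit_ord hμ).bot_lt⟩⟩
  obtain ⟨e, he⟩ : ∃ e : Ordinal.{u} → Ordinal.{u} → Ordinal.{u}, ∀ δ,
      (∃ f, IsLadder (Order.succ μ).ord δ f) → IsLadder (Order.succ μ).ord δ (e δ) := by
    have : ∀ δ, ∃ e, (∃ f, IsLadder (Order.succ μ).ord δ f) → IsLadder (Order.succ μ).ord δ e := by
      intro δ
      by_cases h : ∃ f, IsLadder (Order.succ μ).ord δ f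
      · exact h.imp fun f hf _ => hf
      · exact ⟨id, fun h' => (h h').elim⟩
    exact ⟨_, fun δ => (this δ).choose_spec⟩
  obtain ⟨r, hr⟩ : ∃ r : Ordinal.{u} → Set.Iio μ.ord → Bool,
      Set.InjOn r (Set.Iio (Order.succ μ).ord) := by
    have h : #(Set.Iio (Order.succ μ).ord) ≤ #(Set.Iio μ.ord → Bool) := by
      rw [Cardinal.mk_Iio_ordinal, Cardinal.card_ord, Cardinal.mk_pi]
      simpa [hK] using Cardinal.lift_le.{u + 1}.2 (Order.succ_le_of_lt hμθ)
    obtain ⟨j⟩ := h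
    refine ⟨fun α => if h : α < (Order.succ μ).ord then j ⟨α, h⟩ else fun _ => true,
      fun α hα β hβ h => ?_⟩
    simp only [Set.mem_Iio.1 hα, Set.mem_Iio.1 hβ, dif_pos] at h
    exact congrArg Subtype.val (j.injective h)
  have hsucc : Order.succ μ < κ := hκ ▸ Order.succ_lt_succ hμθ
  obtain ⟨Ψ, hΨ⟩ := exists_club_guess hκreg hreg (hμ.trans_lt (Order.lt_succ μ)) hsucc e he
  let G : SimpleGraph (GapVertex κ (Set.Iio μ.ord)) := gapGraph (Order.succ μ).ord Ψ r e
  refine ⟨Shrink.{u} (GapVertex κ (Set.Iio μ.ord)), G.comap (equivShrink _).symm, ?_,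
    EdgeArrow.comap_equiv _ ?_⟩
  · have := Cardinal.lift_mk_shrink' (GapVertex κ (Set.Iio μ.ord))
    rw [Cardinal.lift_id'.{u, u + 1}, mk_gapVertex hμ hκreg.aleph0_le hμκ.le hK] at this
    exact Cardinal.lift_inj.1 this
  intro c
  let c' : GapVertex κ (Set.Iio μ.ord) → GapVertex κ (Set.Iio μ.ord) → Set.Iio μ.ord :=
    fun x y => if h : G.Adj x y then c ⟨s(x, y), h⟩ else Classical.arbitrary _
  obtain ⟨k, W, D₀, h₀, hW⟩ := exists_winning_colour hμ hK hκ hr hΨ c'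
  obtain ⟨F, hinj, hadj, hcol⟩ := exists_tree_of_extends hκreg (hμ.trans_lt hμκ)
    (fun y => y.1.2) (fun y ξ h => h.1) hW h₀
  let f : transitiveTree κ ↪g G :=
    { toFun := F
      inj' := hinj
      map_rel_iff' := fun {s t} => or_congr (hadj s t) (hadj t s) }
  have hmono : ∀ a : (transitiveTree κ).edgeSet, c (f.mapEdgeSet a) = k := by
    have hc : ∀ x y, ∀ h : G.Adj x y, c' x y = k → c ⟨s(x, y), h⟩ = k := fun x y h hk => by
      simpa only [c', dif_pos h] using hk
    rintro ⟨a, ha⟩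
    induction a using Sym2.inductionOn with
    | _ s t =>
    have hG : G.Adj (F s) (F t) := f.map_adj_iff.2 ha
    rcases ha with h | h
    · exact hc _ _ hG (hcol _ _ h)
    · have := hc _ _ hG.symm (hcol _ _ h)
      rw [← this]
      exact congrArg c (Subtype.ext Sym2.eq_swap)
  exact ⟨f, fun a b => (hmono a).trans (hmono b).symm⟩
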